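/- Let $G=(V,E)$ be a finite connected graph (with at least one vertex; loops and parallel edges are allowed). Choose an orientation and an ordering of the edges and a vertex $v_0\in V$. Let $\xi$ be the $|E|\times|V|$ incidence matrix of the resulting directed graph (the entry at $(e,v)$ is $+1$ if $v$ is the head of $e$, $-1$ if $v$ is its tail, $0$ otherwise; the row of a loop is zero), let $\widehat\xi$ be $\xi$ with the column of $v_0$ deleted, let $A$ be the diagonal matrix of independent variables $x_e$, $e\in E$, and put $$M_G=\begin{pmatrix}A&\widehat\xi\\-\widehat\xi^{\,T}&0\end{pmatrix}.$$ For $I,J\subseteq E$ with $|I|=|J|$, let the Dodgson polynomial $\Psi^{I,J}\in\mathbb Z[x_e : e\in E]$ be the determinant of the matrix obtained from $M_G$ by deleting the rows indexed by the edges in $I$ and the columns indexed by the edges in $J$. Let $S\subseteq E$ with $|S|=4$. For every such choice of orientation, ordering and $v_0$, the following are equivalent. (a) There is a partition $S=S_1\cup S_2$ with $|S_1|=|S_2|=2$ such that $\Psi^{S_1,S_2}=0$ (as a polynomial). (b) There exist edge-disjoint subgraphs $G_1,G_2$ of $G$ with $G_1\cup G_2=G$ (that is, $V(G_1)\cup V(G_2)=V$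 and $E(G_1)\cup E(G_2)=E$) such that one of the following holds: 1. $|V(G_1)\cap V(G_2)|\le 2$ and $|E(G_1)\cap S|=2$; 2. $|V(G_1)\cap V(G_2)|=1$ and $|E(G_1)\cap S|=1$. -/

import Mathlib

open scoped Graph

namespace SplitGraph

/-- A (multi)graph is connected if it has a vertex and any two of its vertices are joined by a
walk. -/
def IsConnected {α β : Type*} (G : Graph α β) : Prop :=
  V(G).Nonempty ∧ ∀ x ∈ V(G), ∀ y ∈ V(G), Relation.ReflTransGen G.Adj x y

/-- An orientation of a multigraph: a choice, for each edge, of which of its ends is the tail and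
which is the head (the two coincide exactly when the edge is a loop). -/
structure Orientation {α β : Type*} (G : Graph α β) where
  /-- the initial vertex of an edge -/
  tail : E(G) → V(G)
  /-- the terminal vertex of an edge -/
  head : E(G) → V(G)
  isLink : ∀ e : E(G), G.IsLink (e : β) (tail e : α) (head e : α)

section

variable {α β : Type*} {G : Graph α β} [DecidableEq V(G)]

/-- The incidence matrix `ξ` of the oriented graph, with rows indexed by the edges and columns
indexed by the vertices: `+1` at the head of an edge, `-1` at its tail, and `0` elsewhere. The row
of a loop is zero. -/
def incidence (o : Orientation G) : Matrix E(G) V(G) ℤ :=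
  Matrix.of fun e v => (if o.head e = v then 1 else 0) - (if o.tail e = v then 1 else 0)

/-- The incidence matrix with the column of the vertex `v₀` deleted. -/
def reducedIncidence (o : Orientation G) (v₀ : V(G)) : Matrix E(G) {v : V(G) // v ≠ v₀} ℤ :=
  (incidence o).submatrix id Subtype.val

/-- The exploded Laplacian: the block matrix with the diagonal matrix of the edge variables `x_e` in
the upper left corner, the reduced incidence matrix in the upper right corner, minus its transpose
in the lower left corner, and zero in the lower right corner. -/
noncomputable def explodedLaplacian [DecidableEq E(G)] (o : Orientation G) (v₀ : V(G)) :
    Matrix (E(G) ⊕ {v : V(G) // v ≠ v₀}) (E(G) ⊕ {v : V(G) // v ≠ v₀}) (MvPolynomial E(G) ℤ) :=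
  Matrix.fromBlocks
    (Matrix.diagonal fun e => MvPolynomial.X e)
    ((reducedIncidence o v₀).map MvPolynomial.C)
    (-((reducedIncidence o v₀).map MvPolynomial.C).transpose)
    0

/-- If `I` and `J` have the same size, so have their complements. -/
theorem card_compl_eq {ι : Type*} [Fintype ι] [DecidableEq ι] {I J : Finset ι}
    (h : I.card = J.card) : (Jᶜ).card = (Iᶜ).card := by
  rw [Finset.card_compl, Finset.card_compl, h]

/-- The Dodgson polynomial `Ψ^{I,J}` for edge sets `I`, `J` of the same size: the determinant of the
matrix obtained from the exploded Laplacian by deleting the rows indexed by the edges in `I` and the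
columns indexed by the edges in `J`. The remaining edge rows and the remaining edge columns are both
listed in increasing order with respect to the chosen order of the edges; the vertices index rows
and columns in the same order, so their order is immaterial. -/
noncomputable def dodgson [Fintype V(G)] [Fintype E(G)] [LinearOrder E(G)]
    (o : Orientation G) (v₀ : V(G)) (I J : Finset E(G)) (h : I.card = J.card) :
    MvPolynomial E(G) ℤ :=
  ((explodedLaplacian o v₀).submatrix
    (Sum.map ((Iᶜ).orderEmbOfFin rfl) id)
    (Sum.map ((Jᶜ).orderEmbOfFin (card_compl_eq h)) id)).det

end

end SplitGraph

set_option linter.unusedSectionVars false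

namespace SplitGraph


/-! Write `r` for the rank in the cycle matroid. Both conditions are equivalent to the existence of
a `GoodSide`: a set `X` of edges with two marked edges on each side and `r X + r Xᶜ ≤ |V|`.

For the Dodgson polynomials, fix a splitting `S₁`, `S₂` of `S`. Matroid intersection, applied to the
contractions by `S₁` and by `S₂`, yields a dichotomy (`exists_goodSide_or_bases`). Either some `X ⊇
S₁` with `S₂ ⊆ Xᶜ` has `r X + r Xᶜ ≤ |V|`, or some `U` makes both `U ∪ S₁` and `U ∪ S₂` bases. Such
an `X` forces a kernel vector of the matrix at every rational point, by counting dimensions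
(`exists_isKernelVector`). Such a `U` makes the matrix nonsingular at the point that is `0` on `U`
and `1` elsewhere (`IsKernelVector.eq_zero`).

For the subgraphs, a nonempty connected edge set has rank one less than its number of ends, so the
rank bound limits the number of vertices common to both sides. Two subgraphs as in (b) give a good
side by this count. Conversely, a good side with as few ends as possible has at most two components
on each side, and a side or a suitable union of components gives the subgraphs
(`GoodSide.exists_separates`). -/

/-! ### Matroid intersection for two contractions -/

theorem union_union_insert {E : Type*} [DecidableEq E] (e : E) (A C I : Finset E) :
    A ∪ I ∪ (C ∪ insert e I) = insert e (A ∪ C) ∪ I := by grind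

theorem union_inter_union_insert {E : Type*} [DecidableEq E] {e : E} {A I : Finset E}
    (C : Finset E) (hA : e ∉ A) (hI : e ∉ I) :
    (A ∪ I) ∩ (C ∪ insert e I) = (A ∩ C) ∪ I := by grind

theorem insert_union_union_inter {E : Type*} [DecidableEq E] {e : E} {A B C D R : Finset E}
    (hAB : A ∪ B = R) (hCD : C ∪ D = R) : insert e (A ∪ C) ∪ B ∩ D = insert e R := by grind

theorem disjoint_insert_union_inter {E : Type*} [DecidableEq E] {e : E} {A B C D : Finset E}
    (hAB : Disjoint A B) (hCD : Disjoint C D) (he : e ∉ B) :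
    Disjoint (insert e (A ∪ C)) (B ∩ D) := by
  rw [Finset.disjoint_left] at *
  grind

/-- A weak form of the matroid intersection theorem for one rank function `r` and two contractions
`I`, `J` of it. -/
theorem exists_common_independent {E : Type*} [DecidableEq E] (r : Finset E → ℕ)
    (mono : ∀ A B, A ⊆ B → r A ≤ r B)
    (submod : ∀ A B, r (A ∪ B) + r (A ∩ B) ≤ r A + r B)
    (insert_le : ∀ e A, r (insert e A) ≤ r A + 1) (R : Finset E) :
    ∀ (I J : Finset E) (k : ℕ), Disjoint I R → Disjoint J R → r I = I.card → r J = J.card →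
      (∀ A B, A ∪ B = R → Disjoint A B → I.card + J.card + k ≤ r (A ∪ I) + r (B ∪ J)) →
      ∃ U ⊆ R, U.card = k ∧ r (U ∪ I) = (U ∪ I).card ∧ r (U ∪ J) = (U ∪ J).card := by
  induction R using Finset.induction_on with
  | empty =>
    intro I J k _ _ hI hJ h
    have := h ∅ ∅ (by simp) (by simp)
    simp only [Finset.empty_union] at this
    exact ⟨∅, le_rfl, by simp; omega, by simpa using hI, by simpa using hJ⟩
  | insert e R he ih =>
    intro I J k hIR hJR hI hJ h
    rw [Finset.disjoint_insert_right] at hIR hJR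
    -- Either the bound survives the deletion of `e`, or a violating partition `(A, B)` of `R` is
    -- kept and `e` is contracted, that is, added to both `I` and `J`.
    by_cases hdel : ∀ A B, A ∪ B = R → Disjoint A B →
        I.card + J.card + k ≤ r (A ∪ I) + r (B ∪ J)
    · obtain ⟨U, hU, h'⟩ := ih I J k hIR.2 hJR.2 hI hJ hdel
      exact ⟨U, hU.trans (Finset.subset_insert _ _), h'⟩
    push Not at hdel
    obtain ⟨A, B, hAB, hd, hlt⟩ := hdel
    have heA : e ∉ A := fun hh => he (hAB ▸ Finset.mem_union_left _ hh)
    have heB : e ∉ B := fun hh => he (hAB ▸ Finset.mem_union_right _ hh)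
    have key : ∀ (A I : Finset E), e ∉ A → e ∉ I → r (insert e I) = r I →
        r (insert e A ∪ I) ≤ r (A ∪ I) := by
      intro A I hA hI' hr
      have h1 := submod (A ∪ I) (insert e I)
      have h2 : A ∪ I ∪ insert e I = insert e A ∪ I := by grind
      have h3 : (A ∪ I) ∩ insert e I = I := by grind
      rw [h2, h3] at h1
      omega
    -- If `e` were in the closure of `I`, adding it to `A` would leave the rank unchanged, and
    -- `(insert e A, B)` would violate the hypothesis.
    have hI1 : r (insert e I) = (insert e I).card := by
      rw [Finset.card_insert_of_notMem hIR.1]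
      have h1 := insert_le e I
      have h2 := mono _ _ (Finset.subset_insert e I)
      by_contra hne
      have h3 := key A I heA hIR.1 (by omega)
      have h4 := h (insert e A) B (by rw [Finset.insert_union, hAB])
        (Finset.disjoint_insert_left.2 ⟨heB, hd⟩)
      omega
    have hJ1 : r (insert e J) = (insert e J).card := by
      rw [Finset.card_insert_of_notMem hJR.1]
      have h1 := insert_le e J
      have h2 := mono _ _ (Finset.subset_insert e J)
      by_contra hne
      have h3 := key B J heB hJR.1 (by omega)
      have h4 := h A (insert e B) (by rw [Finset.union_insert, hAB])
        (Finset.disjoint_insert_right.2 ⟨heA, hd⟩)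
      omega
    -- The contraction below uses the truncated difference `k - 1`.
    rcases Nat.eq_zero_or_pos k with rfl | hk
    · exact ⟨∅, by simp, by simp, by simpa using hI, by simpa using hJ⟩
    -- Uncrossing: submodularity pairs `(A, B)` with `(C, D)`, and the hypothesis is applied to both
    -- resulting partitions of `insert e R`. The strict violation at `(A, B)` supplies the extra
    -- unit needed after contraction.
    have hcontr : ∀ C D, C ∪ D = R → Disjoint C D →
        (insert e I).card + (insert e J).card + (k - 1) ≤
          r (C ∪ insert e I) + r (D ∪ insert e J) := by
      intro C D hCD hd'
      rw [Finset.card_insert_of_notMem hIR.1, Finset.card_insert_of_notMem hJR.1]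
      have heC : e ∉ C := fun hh => he (hCD ▸ Finset.mem_union_left _ hh)
      have heD : e ∉ D := fun hh => he (hCD ▸ Finset.mem_union_right _ hh)
      have s1 := submod (A ∪ I) (C ∪ insert e I)
      have s2 := submod (B ∪ J) (D ∪ insert e J)
      rw [union_union_insert, union_inter_union_insert C heA hIR.1] at s1
      rw [union_union_insert, union_inter_union_insert D heB hJR.1] at s2
      have p1 := h (insert e (A ∪ C)) (B ∩ D) (insert_union_union_inter hAB hCD)
        (disjoint_insert_union_inter hd hd' heB)
      have p2 := h (A ∩ C) (insert e (B ∪ D))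
        (by rw [Finset.union_comm]
            exact insert_union_union_inter ((Finset.union_comm _ _).trans hAB)
              ((Finset.union_comm _ _).trans hCD))
        (disjoint_insert_union_inter hd.symm hd'.symm heA).symm
      omega
    obtain ⟨U, hU, hc, h1, h2⟩ := ih (insert e I) (insert e J) (k - 1)
      (Finset.disjoint_insert_left.2 ⟨he, hIR.2⟩) (Finset.disjoint_insert_left.2 ⟨he, hJR.2⟩)
      hI1 hJ1 hcontr
    refine ⟨insert e U, Finset.insert_subset_insert _ hU, ?_, ?_, ?_⟩
    · rw [Finset.card_insert_of_notMem (fun hh => he (hU hh))]; omega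
    · rwa [Finset.insert_union, ← Finset.union_insert]
    · rwa [Finset.insert_union, ← Finset.union_insert]

/-! ### Rank and ends of edge sets -/

section rank

variable {V E : Type*} [Fintype V] [DecidableEq V] [DecidableEq E] (t h : E → V)

/-- The row of an edge in the incidence matrix. -/
def edgeVec (e : E) : V → ℚ := Pi.single (h e) 1 - Pi.single (t e) 1

/-- The rank of a set of edges in the cycle matroid. -/
noncomputable def edgeRank (X : Finset E) : ℕ :=
  Module.finrank ℚ (Submodule.span ℚ (edgeVec t h '' X))

/-- The set of ends of a set of edges. -/
def ends (X : Finset E) : Finset V := X.image t ∪ X.image h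

variable {t h}

theorem mem_ends {X : Finset E} {v : V} : v ∈ ends t h X ↔ ∃ e ∈ X, t e = v ∨ h e = v := by
  simp only [ends, Finset.mem_union, Finset.mem_image]
  grind

theorem ends_union (X Y : Finset E) : ends t h (X ∪ Y) = ends t h X ∪ ends t h Y := by
  ext v; simp only [mem_ends, Finset.mem_union]; grind

theorem ends_mono {X Y : Finset E} (hXY : X ⊆ Y) : ends t h X ⊆ ends t h Y := by
  intro v; simp only [mem_ends]; grind

theorem edgeRank_mono (A B : Finset E) (hAB : A ⊆ B) : edgeRank t h A ≤ edgeRank t h B :=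
  Submodule.finrank_mono (Submodule.span_mono (Set.image_mono (by exact_mod_cast hAB)))

theorem span_edgeVec_union (A B : Finset E) :
    Submodule.span ℚ (edgeVec t h '' (A ∪ B : Finset E)) =
      Submodule.span ℚ (edgeVec t h '' A) ⊔ Submodule.span ℚ (edgeVec t h '' B) := by
  rw [Finset.coe_union, Set.image_union, Submodule.span_union]

theorem edgeRank_union_add_inter_le (A B : Finset E) :
    edgeRank t h (A ∪ B) + edgeRank t h (A ∩ B) ≤ edgeRank t h A + edgeRank t h B := by
  unfold edgeRank
  rw [span_edgeVec_union, ← Submodule.finrank_sup_add_finrank_inf_eq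
    (Submodule.span ℚ (edgeVec t h '' A)) (Submodule.span ℚ (edgeVec t h '' B))]
  refine Nat.add_le_add_left (Submodule.finrank_mono (le_inf ?_ ?_)) _ <;>
    refine Submodule.span_mono (Set.image_mono ?_) <;> simp

theorem edgeRank_le_card (A : Finset E) : edgeRank t h A ≤ A.card := by
  unfold edgeRank
  rw [← Finset.coe_image]
  exact (finrank_span_finset_le_card _).trans Finset.card_image_le

theorem edgeRank_union_le (A B : Finset E) :
    edgeRank t h (A ∪ B) ≤ edgeRank t h A + edgeRank t h B :=
  le_of_add_le_left (edgeRank_union_add_inter_le A B)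

theorem edgeRank_insert_le (e : E) (A : Finset E) :
    edgeRank t h (insert e A) ≤ edgeRank t h A + 1 := by
  have h1 := edgeRank_union_le (t := t) (h := h) {e} A
  have h2 := edgeRank_le_card (t := t) (h := h) {e}
  rw [← Finset.insert_eq] at h1
  simp at h2
  omega

/-- All edge vectors lie in the span of the differences between a fixed vertex of `T` and the
others. -/
theorem edgeRank_add_one_le {X : Finset E} {T : Finset V} (hX : ends t h X ⊆ T)
    (hT : T.Nonempty) : edgeRank t h X + 1 ≤ T.card := by
  obtain ⟨v, hv⟩ := hT
  let f : V → V → ℚ := fun u => Pi.single u 1 - Pi.single v 1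
  have key : ∀ u ∈ T, f u ∈ Submodule.span ℚ ((T.erase v).image f : Set (V → ℚ)) := by
    intro u hu
    by_cases huv : u = v
    · simp [f, huv]
    · exact Submodule.subset_span (Finset.mem_coe.2
        (Finset.mem_image_of_mem f (Finset.mem_erase.2 ⟨huv, hu⟩)))
  have hle : Submodule.span ℚ (edgeVec t h '' X) ≤
      Submodule.span ℚ ((T.erase v).image f : Set (V → ℚ)) := by
    rw [Submodule.span_le]
    rintro _ ⟨e, he, rfl⟩
    have h1 : edgeVec t h e = f (h e) - f (t e) := by simp [edgeVec, f]
    rw [h1]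
    exact Submodule.sub_mem _ (key _ (hX (mem_ends.2 ⟨e, he, Or.inr rfl⟩)))
      (key _ (hX (mem_ends.2 ⟨e, he, Or.inl rfl⟩)))
  have h2 : edgeRank t h X ≤ (T.erase v).card :=
    (Submodule.finrank_mono hle).trans ((finrank_span_finset_le_card _).trans Finset.card_image_le)
  rw [Finset.card_erase_of_mem hv] at h2
  have := Finset.card_pos.2 ⟨v, hv⟩
  omega

theorem apply_eq_zero_of_mem_span_edgeVec {X : Finset E} {v : V} (hv : v ∉ ends t h X)
    {f : V → ℚ} (hf : f ∈ Submodule.span ℚ (edgeVec t h '' X)) : f v = 0 := by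
  have : Submodule.span ℚ (edgeVec t h '' X) ≤
      LinearMap.ker (LinearMap.proj v : (V → ℚ) →ₗ[ℚ] ℚ) := by
    rw [Submodule.span_le]
    rintro _ ⟨e, he, rfl⟩
    have h1 : v ≠ h e := fun hh => hv (mem_ends.2 ⟨e, he, Or.inr hh.symm⟩)
    have h2 : v ≠ t e := fun hh => hv (mem_ends.2 ⟨e, he, Or.inl hh.symm⟩)
    simp [edgeVec, h1, h2]
  exact this hf

/-- Vectors in the two spans have disjoint supports, so the spans meet only in zero. -/
theorem edgeRank_add_le_of_disjoint_ends {A B : Finset E}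
    (hd : Disjoint (ends t h A) (ends t h B)) :
    edgeRank t h A + edgeRank t h B ≤ edgeRank t h (A ∪ B) := by
  unfold edgeRank
  rw [span_edgeVec_union, ← Submodule.finrank_sup_add_finrank_inf_eq]
  have : Submodule.span ℚ (edgeVec t h '' (A : Set E)) ⊓
      Submodule.span ℚ (edgeVec t h '' (B : Set E)) = ⊥ := by
    rw [eq_bot_iff]
    rintro f ⟨hA, hB⟩
    rw [Submodule.mem_bot]
    funext v
    by_cases hv : v ∈ ends t h A
    · exact apply_eq_zero_of_mem_span_edgeVec (Finset.disjoint_left.1 hd hv) hB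
    · exact apply_eq_zero_of_mem_span_edgeVec hv hA
  rw [this, finrank_bot, add_zero]

theorem edgeRank_lt_insert {X : Finset E} {e : E} {v w : V}
    (hvw : t e = w ∧ h e = v ∨ t e = v ∧ h e = w) (hne : v ≠ w) (hv : v ∉ ends t h X) :
    edgeRank t h X < edgeRank t h (insert e X) := by
  refine Submodule.finrank_lt_finrank_of_lt (lt_of_le_of_ne
    (Submodule.span_mono (Set.image_mono (by simp))) fun heq => ?_)
  have hmem : edgeVec t h e ∈ Submodule.span ℚ (edgeVec t h '' X) := by
    rw [heq]
    exact Submodule.subset_span ⟨e, by simp, rfl⟩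
  have := apply_eq_zero_of_mem_span_edgeVec hv hmem
  rcases hvw with ⟨h1, h2⟩ | ⟨h1, h2⟩ <;> simp [edgeVec, h1, h2, hne] at this

/-- A set of edges is unsplittable if it is not the union of two nonempty sets of edges without a
common end. -/
def Unsplittable (t h : E → V) (T : Finset E) : Prop :=
  ∀ C C' : Finset E, C ∪ C' = T → C.Nonempty → C'.Nonempty →
    ¬ Disjoint (ends t h C) (ends t h C')

/-- Take a largest subset `X` satisfying the bound. If edges remain, one of them meets `X`; it
brings at most one new end, and when it brings one the rank also grows, contradicting maximality. -/
theorem Unsplittable.card_ends_le {T : Finset E} (hT : Unsplittable t h T) :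
    (ends t h T).card ≤ edgeRank t h T + 1 := by
  rcases T.eq_empty_or_nonempty with rfl | ⟨e₀, he₀⟩
  · simp [ends]
  have hne : (T.powerset.filter fun X =>
      X.Nonempty ∧ (ends t h X).card ≤ edgeRank t h X + 1).Nonempty := by
    refine ⟨{e₀}, ?_⟩
    simp only [Finset.mem_filter, Finset.mem_powerset, Finset.singleton_subset_iff]
    refine ⟨he₀, by simp, ?_⟩
    by_cases hloop : h e₀ = t e₀
    · simp [ends, hloop]
    · have h1 := edgeRank_lt_insert (t := t) (h := h) (X := ∅) (e := e₀) (Or.inl ⟨rfl, rfl⟩) hloop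
        (by simp [ends])
      have h2 : (ends t h {e₀}).card ≤ 2 := by
        simpa [ends] using Finset.card_le_two (a := t e₀) (b := h e₀)
      simp only [insert_empty_eq] at h1
      omega
  obtain ⟨X, hX, hmax⟩ := Finset.exists_max_image _ Finset.card hne
  simp only [Finset.mem_filter, Finset.mem_powerset] at hX hmax
  obtain ⟨hXT, hXne, hXc⟩ := hX
  by_cases hXe : X = T
  · rwa [hXe] at hXc
  exfalso
  have hrest : (T \ X).Nonempty := by
    rw [Finset.nonempty_iff_ne_empty, Ne, Finset.sdiff_eq_empty_iff_subset]
    exact fun hh => hXe (hXT.antisymm hh)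
  have hnd := hT X (T \ X) (Finset.union_sdiff_of_subset hXT) hXne hrest
  rw [Finset.not_disjoint_iff] at hnd
  obtain ⟨w, hwX, hw⟩ := hnd
  obtain ⟨e, he, hew⟩ := mem_ends.1 hw
  rw [Finset.mem_sdiff] at he
  obtain ⟨v, hv⟩ : ∃ v, t e = w ∧ h e = v ∨ t e = v ∧ h e = w := by
    rcases hew with h1 | h1
    · exact ⟨h e, Or.inl ⟨h1, rfl⟩⟩
    · exact ⟨t e, Or.inr ⟨rfl, h1⟩⟩
  have hends : ends t h (insert e X) = insert v (ends t h X) := by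
    ext u
    simp only [mem_ends, Finset.mem_insert] at hwX ⊢
    grind
  have hcard : (ends t h (insert e X)).card ≤ edgeRank t h (insert e X) + 1 := by
    rw [hends]
    by_cases hvX : v ∈ ends t h X
    · rw [Finset.insert_eq_of_mem hvX]
      exact hXc.trans (Nat.add_le_add_right (edgeRank_mono _ _ (by simp)) 1)
    · have := edgeRank_lt_insert hv (fun hh => hvX (hh ▸ hwX)) hvX
      rw [Finset.card_insert_of_notMem hvX]
      omega
  have := hmax (insert e X) ⟨Finset.insert_subset he.1 hXT, by simp, hcard⟩
  rw [Finset.card_insert_of_notMem he.2] at this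
  omega

end rank


/-! ### From a good side to a small vertex separation -/

section separation

variable {V E : Type*} [Fintype V] [DecidableEq V] [Fintype E] [DecidableEq E] {t h : E → V}

theorem card_union_inter_of_disjoint {C C' : Finset E} (S : Finset E) (hd : Disjoint C C') :
    ((C ∪ C') ∩ S).card = (C ∩ S).card + (C' ∩ S).card := by
  rw [Finset.union_inter_distrib_right, Finset.card_union_of_disjoint]
  exact hd.mono Finset.inter_subset_left Finset.inter_subset_left

theorem disjoint_of_disjoint_ends {C C' : Finset E} (hd : Disjoint (ends t h C) (ends t h C')) :
    Disjoint C C' := by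
  rw [Finset.disjoint_left] at *
  exact fun e he he' => hd (mem_ends.2 ⟨e, he, Or.inl rfl⟩) (mem_ends.2 ⟨e, he', Or.inl rfl⟩)

/-- A set of edges is a good side if its rank and that of its complement are small and it contains
exactly two of the four marked edges. -/
structure GoodSide (t h : E → V) (S X : Finset E) : Prop where
  card_inter : (X ∩ S).card = 2
  card_compl_inter : (Xᶜ ∩ S).card = 2
  rank_le : edgeRank t h X + edgeRank t h Xᶜ ≤ Fintype.card V

theorem GoodSide.compl {S X : Finset E} (hX : GoodSide t h S X) : GoodSide t h S Xᶜ where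
  card_inter := hX.card_compl_inter
  card_compl_inter := by rw [compl_compl]; exact hX.card_inter
  rank_le := by rw [compl_compl, add_comm]; exact hX.rank_le

theorem compl_eq_compl_union {C C' : Finset E} (hd : Disjoint C C') :
    C'ᶜ = (C ∪ C')ᶜ ∪ C := by
  rw [Finset.disjoint_left] at hd
  ext e
  simp only [Finset.mem_compl, Finset.mem_union]
  have := @hd e
  tauto

/-- A piece of a good side without marked edges can be moved to the other side. -/
theorem GoodSide.move {S C C' : Finset E} (hX : GoodSide t h S (C ∪ C'))
    (hd : Disjoint (ends t h C) (ends t h C')) (hC : (C ∩ S).card = 0) :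
    GoodSide t h S C' := by
  have hdis := disjoint_of_disjoint_ends hd
  have hcompl := compl_eq_compl_union hdis
  have hdis2 : Disjoint (C ∪ C')ᶜ C :=
    (disjoint_compl_left (a := C ∪ C')).mono_right Finset.subset_union_left
  refine ⟨?_, ?_, ?_⟩
  · have := hX.card_inter
    rw [card_union_inter_of_disjoint S hdis] at this
    omega
  · rw [hcompl, card_union_inter_of_disjoint S hdis2, hX.card_compl_inter, hC]
  -- Rank is additive over `C` and `C'`, so the first side loses at least `r C` while the second
  -- gains at most that much.
  · have h1 := edgeRank_add_le_of_disjoint_ends hd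
    have h2 := edgeRank_union_le (t := t) (h := h) (C ∪ C')ᶜ C
    rw [← hcompl] at h2
    have := hX.rank_le
    omega

/-- Every set of edges other than the empty set and the full set shares an end with its
complement. -/
def Linked (t h : E → V) : Prop :=
  ∀ T : Finset E, T.Nonempty → Tᶜ.Nonempty → ¬ Disjoint (ends t h T) (ends t h Tᶜ)

/-- By linkedness `C` meets its complement, and it cannot meet `C'`; so it shares a vertex with the
other side, and this vertex is no longer counted twice after the move. -/
theorem card_ends_move_lt (hconn : Linked t h) {C C' : Finset E}
    (hd : Disjoint (ends t h C) (ends t h C')) (hC : C.Nonempty) (hC' : C'.Nonempty) :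
    (ends t h C').card + (ends t h C'ᶜ).card <
      (ends t h (C ∪ C')).card + (ends t h (C ∪ C')ᶜ).card := by
  have hdis := disjoint_of_disjoint_ends hd
  have hcompl := compl_eq_compl_union hdis
  have hcompl' := compl_eq_compl_union hdis.symm
  have hnd := hconn C hC (hC'.mono fun e he => Finset.mem_compl.2
    (Finset.disjoint_right.1 hdis he))
  rw [hcompl', ends_union, Finset.disjoint_union_right, not_and_or, or_iff_left (not_not.2 hd),
    Finset.union_comm C' C, Finset.disjoint_iff_inter_eq_empty, ← Ne,
    ← Finset.nonempty_iff_ne_empty, ← Finset.card_pos] at hnd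
  have h1 := Finset.card_union_add_card_inter (ends t h (C ∪ C')ᶜ) (ends t h C)
  rw [hcompl, ends_union, ends_union, Finset.card_union_of_disjoint hd]
  rw [Finset.inter_comm] at hnd
  omega

/-- A side that cannot be shrunk by moving a piece without marked edges to the other side. -/
def Reduced (t h : E → V) (S X : Finset E) : Prop :=
  ∀ C C' : Finset E, C ∪ C' = X → C.Nonempty → C'.Nonempty →
    Disjoint (ends t h C) (ends t h C') → (C ∩ S).card ≠ 0

/-- A good side minimizing the total number of ends of both sides works: moving an unmarked piece
would lower the total. -/
theorem exists_reduced_goodSide (hconn : Linked t h) {S X : Finset E} (hX : GoodSide t h S X) :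
    ∃ Y, GoodSide t h S Y ∧ Reduced t h S Y ∧ Reduced t h S Yᶜ := by
  classical
  obtain ⟨Y, hY, hmin⟩ := Finset.exists_min_image
    (Finset.univ.filter fun Y => GoodSide t h S Y)
    (fun Y => (ends t h Y).card + (ends t h Yᶜ).card) ⟨X, by simpa using hX⟩
  simp only [Finset.mem_filter, Finset.mem_univ, true_and] at hY hmin
  refine ⟨Y, hY, ?_, ?_⟩
  · rintro C C' rfl hC hC' hd h0
    have h1 := hmin C' (hY.move hd h0)
    have h2 := card_ends_move_lt hconn hd hC hC'
    omega
  · intro C C' hCC hC hC' hd h0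
    have hY' := hY.compl
    rw [← hCC] at hY'
    have h1 := hmin C' (hY'.move hd h0)
    have h2 := card_ends_move_lt hconn hd hC hC'
    rw [hCC, compl_compl] at h2
    omega

/-- A decomposition of a set of edges into two unsplittable pieces with one marked edge each. -/
structure TwoPieces (t h : E → V) (S X C C' : Finset E) : Prop where
  union_eq : C ∪ C' = X
  disjoint : Disjoint (ends t h C) (ends t h C')
  card_left : (C ∩ S).card = 1
  card_right : (C' ∩ S).card = 1
  rank_left : (ends t h C).card ≤ edgeRank t h C + 1
  rank_right : (ends t h C').card ≤ edgeRank t h C' + 1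

/-- Any splitting of `C` also splits `X`, so both parts would need a marked edge, but `C` has only
one. -/
theorem Reduced.unsplittable {S X C C' : Finset E} (hX : Reduced t h S X) (hCC : C ∪ C' = X)
    (hd : Disjoint (ends t h C) (ends t h C')) (hC : (C ∩ S).card = 1) :
    Unsplittable t h C := by
  have key : ∀ D D' : Finset E, D ∪ D' = C → D.Nonempty → D'.Nonempty →
      Disjoint (ends t h D) (ends t h D') → (D ∩ S).card ≠ 0 := by
    intro D D' hDD hD hD' hdd
    refine hX D (D' ∪ C') (by rw [← Finset.union_assoc, hDD, hCC]) hD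
      (hD'.mono Finset.subset_union_left) ?_
    rw [ends_union, Finset.disjoint_union_right]
    exact ⟨hdd, hd.mono_left (ends_mono (hDD ▸ Finset.subset_union_left))⟩
  intro D D' hDD hD hD' hdd
  have h1 := key D D' hDD hD hD' hdd
  have h2 := key D' D (by rwa [Finset.union_comm]) hD' hD hdd.symm
  rw [← hDD, card_union_inter_of_disjoint S (disjoint_of_disjoint_ends hdd)] at hC
  omega

theorem Reduced.card_ends_le_or_twoPieces {S X : Finset E} (hX : Reduced t h S X)
    (hXS : (X ∩ S).card = 2) :
    (ends t h X).card ≤ edgeRank t h X + 1 ∨ ∃ C C', TwoPieces t h S X C C' := by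
  by_cases hun : Unsplittable t h X
  · exact Or.inl hun.card_ends_le
  right
  unfold Unsplittable at hun
  push Not at hun
  obtain ⟨C, C', hCC, hC, hC', hd⟩ := hun
  have h1 := hX C C' hCC hC hC' hd
  have h2 := hX C' C (by rwa [Finset.union_comm]) hC' hC hd.symm
  have h3 := card_union_inter_of_disjoint S (disjoint_of_disjoint_ends hd)
  rw [hCC, hXS] at h3
  have c1 : (C ∩ S).card = 1 := by omega
  have c2 : (C' ∩ S).card = 1 := by omega
  exact ⟨C, C', hCC, hd, c1, c2, (hX.unsplittable hCC hd c1).card_ends_le,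
    (hX.unsplittable (by rwa [Finset.union_comm]) hd.symm c2).card_ends_le⟩

/-- A set of edges splits the marked edges if few vertices are shared with its complement. -/
def Separates (t h : E → V) (S P : Finset E) : Prop :=
  ((ends t h P ∩ ends t h Pᶜ).card ≤ 2 ∧ (P ∩ S).card = 2) ∨
    ((ends t h P ∩ ends t h Pᶜ).card = 1 ∧ (P ∩ S).card = 1)

theorem TwoPieces.symm {S X C C' : Finset E} (hX : TwoPieces t h S X C C') :
    TwoPieces t h S X C' C :=
  ⟨by rw [Finset.union_comm]; exact hX.union_eq, hX.disjoint.symm, hX.card_right, hX.card_left,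
    hX.rank_right, hX.rank_left⟩

theorem TwoPieces.card_ends {S X C C' : Finset E} (hX : TwoPieces t h S X C C') :
    (ends t h X).card = (ends t h C).card + (ends t h C').card := by
  rw [← hX.union_eq, ends_union, Finset.card_union_of_disjoint hX.disjoint]

theorem TwoPieces.card_inter {S X C C' : Finset E} (hX : TwoPieces t h S X C C') (T : Finset V) :
    (ends t h X ∩ T).card = (ends t h C ∩ T).card + (ends t h C' ∩ T).card := by
  rw [← hX.union_eq, ends_union, Finset.union_inter_distrib_right, Finset.card_union_of_disjoint]
  exact hX.disjoint.mono Finset.inter_subset_left Finset.inter_subset_left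

theorem TwoPieces.rank {S X C C' : Finset E} (hX : TwoPieces t h S X C C') :
    (ends t h X).card ≤ edgeRank t h X + 2 := by
  have h1 := edgeRank_add_le_of_disjoint_ends hX.disjoint
  rw [hX.union_eq] at h1
  have := hX.rank_left
  have := hX.rank_right
  rw [hX.card_ends]
  omega

/-- The piece `C` meets its complement only through `Xᶜ`, and linkedness rules out an empty
intersection, so exactly one vertex is shared. -/
theorem TwoPieces.separates (hconn : Linked t h) {S X C C' : Finset E}
    (hX : TwoPieces t h S X C C') (hle : (ends t h C ∩ ends t h Xᶜ).card ≤ 1) :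
    ∃ P, Separates t h S P := by
  have hdis := disjoint_of_disjoint_ends hX.disjoint
  have hC : C.Nonempty := by
    rw [Finset.nonempty_iff_ne_empty]; rintro rfl; simpa using hX.card_left
  have hC' : C'.Nonempty := by
    rw [Finset.nonempty_iff_ne_empty]; rintro rfl; simpa using hX.card_right
  have hnd := hconn C hC (hC'.mono fun e he => Finset.mem_compl.2
    (Finset.disjoint_right.1 hdis he))
  have heq : ends t h C ∩ ends t h Cᶜ = ends t h C ∩ ends t h Xᶜ := by
    rw [compl_eq_compl_union hdis.symm, Finset.union_comm C' C, hX.union_eq, ends_union,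
      Finset.inter_union_distrib_left, Finset.disjoint_iff_inter_eq_empty.1 hX.disjoint,
      Finset.union_empty]
  rw [Finset.disjoint_iff_inter_eq_empty, ← Ne, ← Finset.nonempty_iff_ne_empty,
    ← Finset.card_pos, heq] at hnd
  exact ⟨C, Or.inr ⟨by rw [heq]; omega, hX.card_left⟩⟩

/-- Pieces from both sides, taken together. -/
theorem TwoPieces.separates_union {S X C C' D D' : Finset E}
    (hX : TwoPieces t h S X C C') (hY : TwoPieces t h S Xᶜ D D')
    (hle : (ends t h C ∩ ends t h D').card + (ends t h C' ∩ ends t h D).card ≤ 2) :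
    Separates t h S (C ∪ D) := by
  have hXC : C ⊆ X := hX.union_eq ▸ Finset.subset_union_left
  have hYD : D ⊆ Xᶜ := hY.union_eq ▸ Finset.subset_union_left
  have hCD : Disjoint C D := (disjoint_compl_right (a := X)).mono hXC hYD
  have hcompl : (C ∪ D)ᶜ = C' ∪ D' := by
    have d1 := Finset.disjoint_left.1 (disjoint_of_disjoint_ends hX.disjoint)
    have d2 := Finset.disjoint_left.1 (disjoint_of_disjoint_ends hY.disjoint)
    have m1 : ∀ e, e ∈ C ∨ e ∈ C' ↔ e ∈ X := fun e => by rw [← hX.union_eq, Finset.mem_union]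
    have m2 : ∀ e, e ∈ D ∨ e ∈ D' ↔ e ∉ X := fun e => by
      rw [← Finset.mem_compl, ← hY.union_eq, Finset.mem_union]
    ext e
    have := m1 e
    have := m2 e
    have := @d1 e
    have := @d2 e
    simp only [Finset.mem_compl, Finset.mem_union]
    tauto
  refine Or.inl ⟨?_, by
    rw [card_union_inter_of_disjoint S hCD, hX.card_left, hY.card_left]⟩
  have hsub : ends t h (C ∪ D) ∩ ends t h (C ∪ D)ᶜ ⊆
      (ends t h C ∩ ends t h D') ∪ (ends t h C' ∩ ends t h D) := by
    rw [hcompl, ends_union, ends_union]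
    intro v
    have d1 : v ∈ ends t h C → v ∉ ends t h C' := fun hv => Finset.disjoint_left.1 hX.disjoint hv
    have d2 : v ∈ ends t h D → v ∉ ends t h D' := fun hv => Finset.disjoint_left.1 hY.disjoint hv
    simp only [Finset.mem_inter, Finset.mem_union]
    tauto
  exact (Finset.card_le_card hsub).trans ((Finset.card_union_le _ _).trans hle)

/-- On a reduced good side, the ends exceed the rank by at most the number of pieces, so the two
sides share at most as many vertices as there are pieces in total. With one piece on each side, `Y`
itself separates. With three pieces, at most three vertices are shared, so one half of the divided
side has at most one. With four, at most four vertices are distributed over the pairs of opposite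
pieces, and one of the two ways of regrouping the pieces cuts at most two. -/
theorem GoodSide.exists_separates (hconn : Linked t h) (hcov : ends t h Finset.univ = Finset.univ)
    {S X : Finset E} (hX : GoodSide t h S X) : ∃ P, Separates t h S P := by
  obtain ⟨Y, hY, hr, hr'⟩ := exists_reduced_goodSide hconn hX
  have hcard : (ends t h Y).card + (ends t h Yᶜ).card =
      Fintype.card V + (ends t h Y ∩ ends t h Yᶜ).card := by
    rw [← Finset.card_union_add_card_inter, ← ends_union, Finset.union_compl, hcov,
      Finset.card_univ]
  have hrank := hY.rank_le
  have hcomm := Finset.inter_comm (ends t h Y) (ends t h Yᶜ)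
  rcases hr.card_ends_le_or_twoPieces hY.card_inter with h1 | ⟨C, C', h1⟩ <;>
    rcases hr'.card_ends_le_or_twoPieces hY.card_compl_inter with h2 | ⟨D, D', h2⟩
  · exact ⟨Y, Or.inl ⟨by omega, hY.card_inter⟩⟩
  · have h3 := h2.rank
    have h4 := h2.card_inter (ends t h Y)
    rw [← hcomm] at h4
    rcases Nat.lt_or_ge 1 (ends t h D ∩ ends t h Y).card with h5 | h5
    · exact h2.symm.separates hconn (by rw [compl_compl]; omega)
    · exact h2.separates hconn (by rwa [compl_compl])
  · have h3 := h1.rank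
    have h4 := h1.card_inter (ends t h Yᶜ)
    rcases Nat.lt_or_ge 1 (ends t h C ∩ ends t h Yᶜ).card with h5 | h5
    · exact h1.symm.separates hconn (by omega)
    · exact h1.separates hconn h5
  · have h3 := h1.rank
    have h4 := h2.rank
    have h5 := h1.card_inter (ends t h Yᶜ)
    have h6 := h2.card_inter (ends t h C)
    have h7 := h2.card_inter (ends t h C')
    simp only [Finset.inter_comm _ (ends t h C), Finset.inter_comm _ (ends t h C')] at h6 h7
    rcases Nat.lt_or_ge 2
      ((ends t h C ∩ ends t h D').card + (ends t h C' ∩ ends t h D).card) with h8 | h8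
    · exact ⟨_, h1.separates_union h2.symm (by omega)⟩
    · exact ⟨_, h1.separates_union h2 h8⟩

end separation


/-! ### Dodgson polynomials and kernel vectors -/

section kernel

variable {V E : Type*} [Fintype V] [DecidableEq V] [Fintype E] [DecidableEq E]

/-- The equations, spelled out on the edges and vertices, for a kernel vector of the matrix whose
determinant is the value at `x` of the Dodgson polynomial of `I` and `J`. -/
structure IsKernelVector (t h : E → V) (v₀ : V) (I J : Finset E) (x : E → ℚ) (y : E → ℚ)
    (z : V → ℚ) : Prop where
  edge_eq_zero : ∀ e ∈ J, y e = 0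
  root_eq_zero : z v₀ = 0
  edge_eq : ∀ e ∉ I, x e * y e + (z (h e) - z (t e)) = 0
  vertex_eq : ∀ v, v ≠ v₀ → ∑ e, y e * edgeVec t h e v = 0

theorem edgeVec_dotProduct (t h : E → V) (e : E) (z : V → ℚ) :
    edgeVec t h e ⬝ᵥ z = z (h e) - z (t e) := by
  simp [edgeVec, sub_dotProduct]

end kernel

theorem sum_subtype_ne {V M : Type*} [Fintype V] [DecidableEq V] [AddCommMonoid M] {v₀ : V}
    (f : V → M) (hf : f v₀ = 0) : ∑ v : {v // v ≠ v₀}, f v = ∑ v, f v := by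
  rw [← Finset.sum_erase Finset.univ hf, ← Finset.sum_subtype]
  simp

theorem sum_orderEmbOfFin {ι M : Type*} [Fintype ι] [LinearOrder ι] [AddCommMonoid M]
    (s : Finset ι) {k : ℕ} (hk : s.card = k) (f : ι → M) (hf : ∀ i ∉ s, f i = 0) :
    ∑ i, f (s.orderEmbOfFin hk i) = ∑ i, f i := by
  rw [← Finset.sum_subset (Finset.subset_univ s) (fun i _ hi => hf i hi)]
  conv_rhs => rw [← Finset.image_orderEmbOfFin_univ s hk]
  rw [Finset.sum_image (fun _ _ _ _ hh => (s.orderEmbOfFin hk).injective hh)]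

section graph

variable {α β : Type*} {G : Graph α β} [Fintype V(G)] [DecidableEq V(G)] [Fintype E(G)]
  [LinearOrder E(G)]

/-- The value at `x` of the matrix whose determinant is the Dodgson polynomial. -/
noncomputable def evalMatrix (o : Orientation G) (v₀ : V(G)) (I J : Finset E(G))
    (hIJ : I.card = J.card) (x : E(G) → ℚ) :
    Matrix (Fin (Iᶜ).card ⊕ {v : V(G) // v ≠ v₀}) (Fin (Iᶜ).card ⊕ {v : V(G) // v ≠ v₀}) ℚ :=
  ((explodedLaplacian o v₀).submatrix
    (Sum.map ((Iᶜ).orderEmbOfFin rfl) id)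
    (Sum.map ((Jᶜ).orderEmbOfFin (card_compl_eq hIJ)) id)).map (MvPolynomial.aeval x)

theorem aeval_dodgson (o : Orientation G) (v₀ : V(G)) (I J : Finset E(G))
    (hIJ : I.card = J.card) (x : E(G) → ℚ) :
    MvPolynomial.aeval x (dodgson o v₀ I J hIJ) = (evalMatrix o v₀ I J hIJ x).det := by
  rw [dodgson, AlgHom.map_det]
  rfl

theorem incidence_cast (o : Orientation G) (e : E(G)) (v : V(G)) :
    ((incidence o e v : ℤ) : ℚ) = edgeVec o.tail o.head e v := by
  simp [incidence, edgeVec, Pi.single_apply, eq_comm]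

theorem evalMatrix_mulVec_inl (o : Orientation G) (v₀ : V(G)) (I J : Finset E(G))
    (hIJ : I.card = J.card) (x y : E(G) → ℚ) (z : V(G) → ℚ) (hy : ∀ e ∈ J, y e = 0)
    (hz : z v₀ = 0) (i : Fin (Iᶜ).card) :
    (evalMatrix o v₀ I J hIJ x).mulVec
      (Sum.elim (fun j => y ((Jᶜ).orderEmbOfFin (card_compl_eq hIJ) j)) fun v => z v) (Sum.inl i) =
      x ((Iᶜ).orderEmbOfFin rfl i) * y ((Iᶜ).orderEmbOfFin rfl i) +
        (z (o.head ((Iᶜ).orderEmbOfFin rfl i)) - z (o.tail ((Iᶜ).orderEmbOfFin rfl i))) := by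
  rw [← edgeVec_dotProduct o.tail o.head, Matrix.mulVec, dotProduct, Fintype.sum_sum_type]
  congr 1
  · have := sum_orderEmbOfFin (Jᶜ) (card_compl_eq hIJ)
      (fun e => MvPolynomial.aeval x (Matrix.diagonal (fun e => MvPolynomial.X (R := ℤ) e)
        ((Iᶜ).orderEmbOfFin rfl i) e) * y e)
      (fun e he => by rw [hy e (by simpa using he), mul_zero])
    refine Eq.trans (Eq.trans ?_ this) ?_
    · simp [evalMatrix, explodedLaplacian]
    · simp only [Matrix.diagonal_apply, apply_ite (MvPolynomial.aeval x), MvPolynomial.aeval_X,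
        map_zero, ite_mul, zero_mul, Finset.sum_ite_eq, Finset.mem_univ, if_true]
  · rw [dotProduct, ← sum_subtype_ne (v₀ := v₀) _ (by rw [hz, mul_zero])]
    refine Finset.sum_congr rfl fun v _ => ?_
    rw [← incidence_cast]
    simp [evalMatrix, explodedLaplacian, reducedIncidence]

theorem evalMatrix_mulVec_inr (o : Orientation G) (v₀ : V(G)) (I J : Finset E(G))
    (hIJ : I.card = J.card) (x y : E(G) → ℚ) (z : V(G) → ℚ) (hy : ∀ e ∈ J, y e = 0)
    (v : {v : V(G) // v ≠ v₀}) :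
    (evalMatrix o v₀ I J hIJ x).mulVec
      (Sum.elim (fun j => y ((Jᶜ).orderEmbOfFin (card_compl_eq hIJ) j)) fun v => z v) (Sum.inr v) =
      -∑ e, y e * edgeVec o.tail o.head e v := by
  rw [Matrix.mulVec, dotProduct, Fintype.sum_sum_type,
    ← sum_orderEmbOfFin (Jᶜ) (card_compl_eq hIJ) _
      (fun e he => by rw [hy e (by simpa using he), zero_mul]), ← Finset.sum_neg_distrib]
  simp only [← incidence_cast]
  simp [evalMatrix, explodedLaplacian, reducedIncidence, mul_comm]

/-- Padding with zeros at the deleted columns turns kernel vectors of the square matrix into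
functions on all edges and vertices, which removes the orderings from the problem. -/
theorem aeval_dodgson_eq_zero_iff (o : Orientation G) (v₀ : V(G)) (I J : Finset E(G))
    (hIJ : I.card = J.card) (x : E(G) → ℚ) :
    MvPolynomial.aeval x (dodgson o v₀ I J hIJ) = 0 ↔
      ∃ y z, (y ≠ 0 ∨ z ≠ 0) ∧ IsKernelVector o.tail o.head v₀ I J x y z := by
  rw [aeval_dodgson, ← Matrix.exists_mulVec_eq_zero_iff]
  constructor
  · rintro ⟨w, hw, hker⟩
    set emb := (Jᶜ).orderEmbOfFin (card_compl_eq hIJ) with hemb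
    -- The default value `0` fills the deleted columns `J`, and likewise the root `v₀` in `z`.
    let y : E(G) → ℚ := Function.extend emb (fun j => w (Sum.inl j)) 0
    let z : V(G) → ℚ := fun v => if hv : v ≠ v₀ then w (Sum.inr ⟨v, hv⟩) else 0
    have hyJ : ∀ e ∈ J, y e = 0 := by
      intro e he
      refine Function.extend_apply' _ _ _ ?_
      rintro ⟨j, rfl⟩
      have := Finset.orderEmbOfFin_mem (Jᶜ) (card_compl_eq hIJ) j
      exact Finset.mem_compl.1 this he
    have hz : z v₀ = 0 := by simp [z]
    have hwyz : w = Sum.elim (fun j => y (emb j)) (fun v : {v // v ≠ v₀} => z v) := by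
      funext i
      rcases i with j | v
      · exact (emb.injective.extend_apply (fun j => w (Sum.inl j)) 0 j).symm
      · simp [z, v.2]
    rw [hwyz] at hw hker
    refine ⟨y, z, ?_, hyJ, hz, fun e he => ?_, fun v hv => ?_⟩
    · by_contra hcon
      push Not at hcon
      apply hw
      funext i
      rcases i with j | v <;> simp [hcon.1, hcon.2]
    · have hmem : e ∈ Set.range ((Iᶜ).orderEmbOfFin rfl) := by
        rw [Finset.range_orderEmbOfFin]; simpa using he
      obtain ⟨i, rfl⟩ := hmem
      rw [← evalMatrix_mulVec_inl o v₀ I J hIJ x y z hyJ hz, hker]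
      rfl
    · rw [← neg_eq_zero, ← evalMatrix_mulVec_inr o v₀ I J hIJ x y z hyJ ⟨v, hv⟩, hker]
      rfl
  · rintro ⟨y, z, hne, hk⟩
    refine ⟨Sum.elim (fun j => y ((Jᶜ).orderEmbOfFin (card_compl_eq hIJ) j))
      fun v : {v // v ≠ v₀} => z v, fun h0 => ?_, funext fun i => ?_⟩
    · rcases hne with h1 | h1
      · apply h1
        funext e
        by_cases he : e ∈ J
        · exact hk.edge_eq_zero e he
        · have hmem : e ∈ Set.range ((Jᶜ).orderEmbOfFin (card_compl_eq hIJ)) := by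
            rw [Finset.range_orderEmbOfFin]; simpa using he
          obtain ⟨j, rfl⟩ := hmem
          exact congrFun h0 (Sum.inl j)
      · apply h1
        funext v
        by_cases hv : v = v₀
        · rw [hv]; exact hk.root_eq_zero
        · exact congrFun h0 (Sum.inr ⟨v, hv⟩)
    · rcases i with i | v
      · rw [evalMatrix_mulVec_inl o v₀ I J hIJ x y z hk.edge_eq_zero hk.root_eq_zero]
        exact hk.edge_eq _ (Finset.mem_compl.1 (Finset.orderEmbOfFin_mem _ _ _))
      · rw [evalMatrix_mulVec_inr o v₀ I J hIJ x y z hk.edge_eq_zero, hk.vertex_eq v v.2, neg_zero]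
        rfl

end graph


/-! ### Vanishing by dimension count, nonvanishing from a common set of bases -/

section kernel

variable {V E : Type*} [Fintype V] [DecidableEq V] [Fintype E] [DecidableEq E] {t h : E → V}

theorem edgeRank_eq_finrank_range (X : Finset E) :
    edgeRank t h X = Module.finrank ℚ
      (LinearMap.range (Fintype.linearCombination ℚ fun e : X => edgeVec t h e)) := by
  rw [Fintype.range_linearCombination, edgeRank]
  congr 2
  all_goals rw [show (fun e : X => edgeVec t h e) = edgeVec t h ∘ Subtype.val from rfl,
    Set.range_comp, Subtype.range_coe_subtype]; rfl

theorem edgeRank_eq_rank (X : Finset E) :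
    edgeRank t h X = (Matrix.of fun e : X => edgeVec t h e).rank := by
  rw [Matrix.rank_eq_finrank_span_row, edgeRank]
  congr 2
  all_goals rw [show (Matrix.of fun e : X => edgeVec t h e).row = edgeVec t h ∘ Subtype.val from rfl,
    Set.range_comp, Subtype.range_coe_subtype]; rfl

theorem sum_edge_linearCombination {X : Finset E} {y : E → ℚ} (hy : ∀ e ∉ X, y e = 0) :
    Fintype.linearCombination ℚ (fun e : X => edgeVec t h e) (fun e : X => y e) =
      fun v => ∑ e, y e * edgeVec t h e v := by
  funext v
  rw [Fintype.linearCombination_apply, Finset.sum_apply,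
    ← Finset.sum_subset (Finset.subset_univ X) (fun e _ he => by rw [hy e he, zero_mul]),
    ← Finset.sum_coe_sort X fun e => y e * edgeVec t h e v]
  rfl

/-- It suffices to find `y` supported on `X` with zero boundary and `z` constant along the edges of
`Xᶜ`; the edge equations off `X` then hold automatically. -/
theorem exists_isKernelVector (v₀ : V) {I J X : Finset E} (hIX : I ⊆ X) (hJX : J ⊆ Xᶜ)
    (hI : I.card = 2) (hr : edgeRank t h X + edgeRank t h Xᶜ ≤ Fintype.card V) (x : E → ℚ) :
    ∃ y z, (y ≠ 0 ∨ z ≠ 0) ∧ IsKernelVector t h v₀ I J x y z := by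
  let A := Fintype.linearCombination ℚ fun e : X => edgeVec t h e
  let B := (Matrix.of fun e : (Xᶜ : Finset E) => edgeVec t h e).mulVecLin
  let D : (V → ℚ) →ₗ[ℚ] E → ℚ := (Matrix.of (edgeVec t h)).mulVecLin
  let M : (E → ℚ) →ₗ[ℚ] E → ℚ := LinearMap.mulLeft ℚ x
  let py := LinearMap.fst ℚ (E → ℚ) (V → ℚ)
  let pz := LinearMap.snd ℚ (E → ℚ) (V → ℚ)
  -- The conditions number `|Xᶜ| + 1 + (|X| - 2) + r X + r Xᶜ ≤ |E| + |V| - 1`, one less than the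
  -- number of unknowns. Restricting `A` and `B` to their ranges makes them count by rank.
  let L := (LinearMap.funLeft ℚ ℚ (Subtype.val : (Xᶜ : Finset E) → E) ∘ₗ py).prod
    (((LinearMap.proj v₀ : (V → ℚ) →ₗ[ℚ] ℚ) ∘ₗ pz).prod
      ((LinearMap.funLeft ℚ ℚ (Subtype.val : (X \ I : Finset E) → E) ∘ₗ (M ∘ₗ py + D ∘ₗ pz)).prod
        ((A.rangeRestrict ∘ₗ LinearMap.funLeft ℚ ℚ (Subtype.val : X → E) ∘ₗ py).prod
          (B.rangeRestrict ∘ₗ pz))))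
  have hker : LinearMap.ker L ≠ ⊥ := by
    apply LinearMap.ker_ne_bot_of_finrank_lt
    have hA : Module.finrank ℚ (LinearMap.range A) = edgeRank t h X :=
      (edgeRank_eq_finrank_range X).symm
    have hB : Module.finrank ℚ (LinearMap.range B) = edgeRank t h Xᶜ :=
      (edgeRank_eq_rank Xᶜ).symm
    simp only [Module.finrank_prod, Module.finrank_fintype_fun_eq_card, hA, hB, Fintype.card_coe,
      Module.finrank_self]
    have h1 := Finset.card_sdiff_add_card_eq_card hIX
    have h2 := Finset.card_add_card_compl X
    omega
  obtain ⟨⟨y, z⟩, hmem, hne⟩ := Submodule.exists_mem_ne_zero_of_ne_bot hker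
  have hL : L (y, z) = 0 := hmem
  have e1 : ∀ e ∉ X, y e = 0 := fun e he =>
    congrFun (congrArg Prod.fst hL) ⟨e, Finset.mem_compl.2 he⟩
  have e2 : z v₀ = 0 := congrArg (fun p => p.2.1) hL
  have e3 : ∀ e ∈ X \ I, x e * y e + edgeVec t h e ⬝ᵥ z = 0 := fun e he =>
    congrFun (congrArg (fun p => p.2.2.1) hL) ⟨e, he⟩
  have e4 : A (fun e : X => y e) = 0 := congrArg (fun p => (p.2.2.2.1 : V → ℚ)) hL
  have e5 : ∀ e ∉ X, edgeVec t h e ⬝ᵥ z = 0 := fun e he =>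
    congrFun (congrArg (fun p => (p.2.2.2.2 : (Xᶜ : Finset E) → ℚ)) hL)
      ⟨e, Finset.mem_compl.2 he⟩
  refine ⟨y, z, ?_, fun e he => e1 e (Finset.mem_compl.1 (hJX he)), e2, fun e he => ?_,
    fun v _ => ?_⟩
  · by_contra hcon
    push Not at hcon
    exact hne (Prod.ext hcon.1 hcon.2)
  · rw [← edgeVec_dotProduct]
    by_cases heX : e ∈ X
    · exact e3 e (Finset.mem_sdiff.2 ⟨heX, he⟩)
    · rw [e1 e heX, e5 e heX, mul_zero, add_zero]
  · exact congrFun ((sum_edge_linearCombination e1).symm.trans e4) v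

theorem sum_edgeVec (e : E) : ∑ v, edgeVec t h e v = 0 := by
  simp [edgeVec]

/-- On `U` the variable vanishes and on `J` the coordinate `y` does, so `z` is constant along the
spanning set `U ∪ J` and hence zero. Then `y` vanishes off `U ∪ I`, and independence of `U ∪ I`
kills the rest. -/
theorem IsKernelVector.eq_zero {v₀ : V} {I J U : Finset E} {y : E → ℚ} {z : V → ℚ}
    (hconst : ∀ f : V → ℚ, (∀ e, f (h e) = f (t e)) → ∀ u v, f u = f v)
    (hUI : Disjoint U I) (hI : edgeRank t h (U ∪ I) = (U ∪ I).card)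
    (hJ : edgeRank t h (U ∪ J) + 1 = Fintype.card V) (hIJ : Disjoint I J)
    (hk : IsKernelVector t h v₀ I J (fun e => if e ∈ U then 0 else 1) y z) :
    y = 0 ∧ z = 0 := by
  have hzUJ : ∀ e ∈ U ∪ J, edgeVec t h e ⬝ᵥ z = 0 := by
    intro e he
    rw [edgeVec_dotProduct]
    rcases Finset.mem_union.1 he with heU | heJ
    · simpa [heU] using hk.edge_eq e (Finset.disjoint_left.1 hUI heU)
    · simpa [hk.edge_eq_zero e heJ] using hk.edge_eq e (Finset.disjoint_right.1 hIJ heJ)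
  have hspan : Submodule.span ℚ (edgeVec t h '' (U ∪ J : Finset E)) =
      Submodule.span ℚ (edgeVec t h '' (Finset.univ : Finset E)) := by
    refine Submodule.eq_of_le_of_finrank_le (Submodule.span_mono (Set.image_mono (by simp))) ?_
    have := edgeRank_add_one_le (t := t) (h := h) (Finset.subset_univ (ends t h Finset.univ))
      ⟨v₀, Finset.mem_univ v₀⟩
    rw [Finset.card_univ] at this
    change edgeRank t h _ ≤ edgeRank t h _
    omega
  have hzall : ∀ e, z (h e) = z (t e) := by
    intro e
    rw [← sub_eq_zero, ← edgeVec_dotProduct]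
    have hle : Submodule.span ℚ (edgeVec t h '' (U ∪ J : Finset E)) ≤
        LinearMap.ker ((dotProductBilin ℚ ℚ : (V → ℚ) →ₗ[ℚ] (V → ℚ) →ₗ[ℚ] ℚ).flip z) := by
      rw [Submodule.span_le]
      rintro _ ⟨e, he, rfl⟩
      exact hzUJ e he
    exact hle (hspan ▸ Submodule.subset_span ⟨e, by simp, rfl⟩)
  have hz : z = 0 := by
    funext v
    rw [hconst z hzall v v₀, hk.root_eq_zero]
    rfl
  have hy0 : ∀ e ∉ U ∪ I, y e = 0 := by
    intro e he
    rw [Finset.mem_union, not_or] at he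
    simpa [he.1, hz] using hk.edge_eq e he.2
  have hcomb : (fun v => ∑ e, y e * edgeVec t h e v) = 0 := by
    -- The missing equation at `v₀` follows from the others, because each edge vector has coordinate
    -- sum zero.
    have h0 : ∑ v, ∑ e, y e * edgeVec t h e v = 0 := by
      rw [Finset.sum_comm]
      simp [← Finset.mul_sum, sum_edgeVec]
    funext v
    by_cases hv : v = v₀
    · rw [Finset.sum_eq_single v₀ (fun v _ hv => hk.vertex_eq v hv) (by simp)] at h0
      rw [hv]; exact h0
    · exact hk.vertex_eq v hv
  have hli : LinearIndependent ℚ (fun e : (U ∪ I : Finset E) => edgeVec t h e) := by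
    rw [linearIndependent_iff_card_eq_finrank_span, Set.finrank, ← Fintype.range_linearCombination,
      ← edgeRank_eq_finrank_range, hI, Fintype.card_coe]
  refine ⟨?_, hz⟩
  funext e
  by_cases he : e ∈ U ∪ I
  · rw [← sum_edge_linearCombination hy0] at hcomb
    exact Fintype.linearIndependent_iff.1 hli (fun e => y e) hcomb ⟨e, he⟩
  · exact hy0 e he

theorem exists_goodSide_or_bases (v₀ : V) {S₁ S₂ : Finset E} (h₁ : S₁.card = 2)
    (h₂ : S₂.card = 2) (hd : Disjoint S₁ S₂) :
    (∃ X, GoodSide t h (S₁ ∪ S₂) X) ∨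
      ∃ U, Disjoint U S₁ ∧ edgeRank t h (U ∪ S₁) = (U ∪ S₁).card ∧
        edgeRank t h (U ∪ S₂) + 1 = Fintype.card V := by
  have side : ∀ X, S₁ ⊆ X → S₂ ⊆ Xᶜ → edgeRank t h X + edgeRank t h Xᶜ ≤ Fintype.card V →
      GoodSide t h (S₁ ∪ S₂) X := by
    intro X hX1 hX2 hr
    have d1 : X ∩ S₂ = ∅ := Finset.disjoint_iff_inter_eq_empty.1
      ((disjoint_compl_right (a := X)).mono_right hX2)
    have d2 : Xᶜ ∩ S₁ = ∅ := Finset.disjoint_iff_inter_eq_empty.1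
      ((disjoint_compl_left (a := X)).mono_right hX1)
    refine ⟨?_, ?_, hr⟩
    · rwa [Finset.inter_union_distrib_left, d1, Finset.union_empty,
        Finset.inter_eq_right.2 hX1]
    · rwa [Finset.inter_union_distrib_left, d2, Finset.empty_union,
        Finset.inter_eq_right.2 hX2]
  have hfull : ∀ X : Finset E, edgeRank t h X + 1 ≤ Fintype.card V := fun X => by
    simpa using edgeRank_add_one_le (t := t) (h := h) (Finset.subset_univ (ends t h X))
      ⟨v₀, Finset.mem_univ v₀⟩
  have hS12 : S₂ ⊆ S₁ᶜ := Finset.subset_compl_iff_disjoint_left.2 hd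
  have hS21 : S₁ ⊆ S₂ᶜ := Finset.subset_compl_iff_disjoint_right.2 hd
  have b1 := edgeRank_le_card (t := t) (h := h) S₁
  have b2 := edgeRank_le_card (t := t) (h := h) S₂
  by_cases r1 : edgeRank t h S₁ = 2
  swap
  -- A dependent `S₁` has rank at most `1`, and its complement has rank at most `|V| - 1`.
  · exact Or.inl ⟨S₁, side _ le_rfl hS12 (by have := hfull S₁ᶜ; omega)⟩
  by_cases r2 : edgeRank t h S₂ = 2
  swap
  · refine Or.inl ⟨S₂ᶜ, side _ hS21 (by rw [compl_compl]) ?_⟩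
    rw [compl_compl]
    have := hfull S₂ᶜ
    omega
  have hV := hfull S₁
  -- A base has `|V| - 1` edges, two of them in `S₁` or `S₂`, which leaves `|V| - 3` for `U`. A
  -- partition violating the bound has rank sum below `|V| + 1`, which is the inequality for a good
  -- side.
  by_cases hcon : ∀ A B, A ∪ B = (S₁ ∪ S₂)ᶜ → Disjoint A B →
      S₁.card + S₂.card + (Fintype.card V - 3) ≤ edgeRank t h (A ∪ S₁) + edgeRank t h (B ∪ S₂)
  · obtain ⟨U, hU, hc, hU1, hU2⟩ := exists_common_independent (edgeRank t h) edgeRank_mono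
      edgeRank_union_add_inter_le edgeRank_insert_le (S₁ ∪ S₂)ᶜ S₁ S₂ (Fintype.card V - 3)
      ((disjoint_compl_right (a := S₁ ∪ S₂)).mono_left Finset.subset_union_left)
      ((disjoint_compl_right (a := S₁ ∪ S₂)).mono_left Finset.subset_union_right)
      (by omega) (by omega) hcon
    have dU := (disjoint_compl_left (a := S₁ ∪ S₂)).mono_left hU
    refine Or.inr ⟨U, dU.mono_right Finset.subset_union_left, hU1, ?_⟩
    rw [hU2, Finset.card_union_of_disjoint (dU.mono_right Finset.subset_union_right)]
    omega
  · push Not at hcon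
    obtain ⟨A, B, hAB, hdAB, hlt⟩ := hcon
    have hcompl : (A ∪ S₁)ᶜ = B ∪ S₂ := by
      have m1 : ∀ e, e ∈ A ∨ e ∈ B ↔ ¬ (e ∈ S₁ ∨ e ∈ S₂) := fun e => by
        rw [← Finset.mem_union, hAB, Finset.mem_compl, Finset.mem_union]
      rw [Finset.disjoint_left] at hdAB hd
      ext e
      have := m1 e
      have := @hdAB e
      have := @hd e
      simp only [Finset.mem_compl, Finset.mem_union]
      tauto
    refine Or.inl ⟨A ∪ S₁, side _ Finset.subset_union_right ?_ ?_⟩ <;> rw [hcompl]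
    · exact Finset.subset_union_right
    · omega

end kernel

/-! ### Connected graphs and the two equivalences -/

section graph

variable {α β : Type*} {G : Graph α β} [Fintype V(G)] [DecidableEq V(G)] [Fintype E(G)]
  [LinearOrder E(G)]

theorem exists_edge_of_adj (o : Orientation G) {a b : α} (hab : G.Adj a b) :
    ∃ e, ((o.tail e : α) = a ∧ (o.head e : α) = b) ∨ ((o.tail e : α) = b ∧ (o.head e : α) = a) := by
  obtain ⟨e, he⟩ := hab
  exact ⟨⟨e, he.edge_mem⟩, (o.isLink ⟨e, he.edge_mem⟩).eq_and_eq_or_eq_and_eq he⟩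

/-- A property of the vertices that is passed on along the edges holds at every vertex as soon as
it holds at one. -/
theorem IsConnected.induction (hG : IsConnected G) (o : Orientation G) (P : V(G) → Prop)
    (hP : ∀ e, P (o.tail e) ↔ P (o.head e)) {u : V(G)} (hu : P u) (v : V(G)) : P v := by
  have key : ∀ b, Relation.ReflTransGen G.Adj u b → ∃ w : V(G), (w : α) = b ∧ P w := by
    intro b hb
    induction hb with
    | refl => exact ⟨u, rfl, hu⟩
    | tail _ hab ih =>
      obtain ⟨w, rfl, hw⟩ := ih
      obtain ⟨e, ⟨h1, h2⟩ | ⟨h1, h2⟩⟩ := exists_edge_of_adj o hab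
      · exact ⟨_, h2, (hP e).1 (Subtype.ext h1 ▸ hw)⟩
      · exact ⟨_, h1, (hP e).2 (Subtype.ext h2 ▸ hw)⟩
  obtain ⟨w, hwv, hw⟩ := key v (hG.2 u u.2 v v.2)
  exact Subtype.ext hwv ▸ hw

/-- If the ends were disjoint, membership of an edge in `T` could be read off from either of its
ends, and would propagate through the whole graph. -/
theorem IsConnected.linked (hG : IsConnected G) (o : Orientation G) : Linked o.tail o.head := by
  rintro T ⟨e, he⟩ ⟨f, hf⟩ hd
  have hiff : ∀ e', e' ∈ T ↔ o.tail e' ∈ ends o.tail o.head T := by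
    intro e'
    refine ⟨fun h1 => mem_ends.2 ⟨e', h1, Or.inl rfl⟩, fun h1 => ?_⟩
    by_contra h2
    exact Finset.disjoint_left.1 hd h1 (mem_ends.2 ⟨e', Finset.mem_compl.2 h2, Or.inl rfl⟩)
  have hiff' : ∀ e', e' ∈ T ↔ o.head e' ∈ ends o.tail o.head T := by
    intro e'
    refine ⟨fun h1 => mem_ends.2 ⟨e', h1, Or.inr rfl⟩, fun h1 => ?_⟩
    by_contra h2
    exact Finset.disjoint_left.1 hd h1 (mem_ends.2 ⟨e', Finset.mem_compl.2 h2, Or.inr rfl⟩)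
  have := hG.induction o (fun v => v ∈ ends o.tail o.head T)
    (fun e' => (hiff e').symm.trans (hiff' e')) ((hiff e).1 he) (o.tail f)
  exact Finset.mem_compl.1 hf ((hiff f).2 this)

theorem IsConnected.ends_univ (hG : IsConnected G) (o : Orientation G) (e : E(G)) :
    ends o.tail o.head Finset.univ = Finset.univ := by
  rw [Finset.eq_univ_iff_forall]
  exact hG.induction o (fun v => v ∈ ends o.tail o.head Finset.univ)
    (fun f => iff_of_true (mem_ends.2 ⟨f, Finset.mem_univ f, Or.inl rfl⟩)
      (mem_ends.2 ⟨f, Finset.mem_univ f, Or.inr rfl⟩))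
    (mem_ends.2 ⟨e, Finset.mem_univ e, Or.inl rfl⟩)

theorem IsConnected.eq_of_forall_edge (hG : IsConnected G) (o : Orientation G) (f : V(G) → ℚ)
    (hf : ∀ e, f (o.head e) = f (o.tail e)) (u v : V(G)) : f u = f v :=
  (hG.induction o (fun w => f w = f u) (fun e => by rw [hf e]) rfl v).symm

theorem exists_dodgson_eq_zero_iff (hG : IsConnected G) (o : Orientation G) (v₀ : V(G))
    {S : Finset E(G)} :
    (∃ (S₁ S₂ : Finset E(G)) (h₁ : S₁.card = 2) (h₂ : S₂.card = 2),
      Disjoint S₁ S₂ ∧ S₁ ∪ S₂ = S ∧ dodgson o v₀ S₁ S₂ (h₁.trans h₂.symm) = 0) ↔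
      ∃ X, GoodSide o.tail o.head S X := by
  constructor
  · rintro ⟨S₁, S₂, h₁, h₂, hd, rfl, h0⟩
    rcases exists_goodSide_or_bases (t := o.tail) (h := o.head) v₀ h₁ h₂ hd with hX |
      ⟨U, hU, hU1, hU2⟩
    · exact hX
    exfalso
    have h3 := (aeval_dodgson_eq_zero_iff o v₀ S₁ S₂ (h₁.trans h₂.symm)
      (fun e => if e ∈ U then 0 else 1)).1 (by rw [h0, map_zero])
    obtain ⟨y, z, hne, hk⟩ := h3
    obtain ⟨hy, hz⟩ := hk.eq_zero (hG.eq_of_forall_edge o) hU hU1 hU2 hd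
    exact hne.elim (fun hh => hh hy) (fun hh => hh hz)
  · rintro ⟨X, hX⟩
    refine ⟨X ∩ S, Xᶜ ∩ S, hX.card_inter, hX.card_compl_inter,
      (disjoint_compl_right (a := X)).mono Finset.inter_subset_left Finset.inter_subset_left,
      by rw [← Finset.union_inter_distrib_right, Finset.union_compl, Finset.univ_inter], ?_⟩
    -- Over the infinite field `ℚ`, a polynomial vanishing at every point is zero.
    apply MvPolynomial.map_injective (Int.castRingHom ℚ) Int.cast_injective
    rw [map_zero]
    refine MvPolynomial.funext fun x => ?_
    rw [map_zero, MvPolynomial.eval_map]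
    exact (aeval_dodgson_eq_zero_iff o v₀ _ _ _ x).2
      (exists_isKernelVector v₀ Finset.inter_subset_left Finset.inter_subset_left hX.card_inter
        hX.rank_le x)

/-- The subgraph formed by a set of edges and their ends. -/
def edgeSubgraph (o : Orientation G) (P : Finset E(G)) : Graph α β where
  vertexSet := (↑) '' (ends o.tail o.head P : Set V(G))
  IsLink e a b := G.IsLink e a b ∧ ∃ f ∈ P, (f : β) = e
  isLink_symm := fun _ _ => ⟨fun _ _ hab => ⟨hab.1.symm, hab.2⟩⟩
  eq_or_eq_of_isLink_of_isLink := fun _ _ _ _ _ h1 h2 =>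
    G.eq_or_eq_of_isLink_of_isLink h1.1 h2.1
  left_mem_of_isLink := by
    rintro _ a b ⟨hab, f, hf, rfl⟩
    rcases (o.isLink f).eq_and_eq_or_eq_and_eq hab with ⟨h1, _⟩ | ⟨_, h1⟩
    · exact ⟨_, mem_ends.2 ⟨f, hf, Or.inl rfl⟩, h1⟩
    · exact ⟨_, mem_ends.2 ⟨f, hf, Or.inr rfl⟩, h1⟩

theorem edgeSubgraph_le (o : Orientation G) (P : Finset E(G)) : edgeSubgraph o P ≤ G where
  vertexSet_mono := by
    rintro _ ⟨v, _, rfl⟩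
    exact v.2
  isLink_mono := fun _ _ _ hab => hab.1

theorem mem_edgeSet_edgeSubgraph (o : Orientation G) (P : Finset E(G)) (e : β) :
    e ∈ E(edgeSubgraph o P) ↔ ∃ f ∈ P, (f : β) = e := by
  constructor
  · rintro ⟨_, _, hab⟩
    exact hab.2
  · rintro ⟨f, hf, rfl⟩
    exact ⟨_, _, o.isLink f, f, hf, rfl⟩

theorem exists_goodSide_iff (hG : IsConnected G) (o : Orientation G) {S : Finset E(G)}
    (hS : S.card = 4) :
    (∃ X, GoodSide o.tail o.head S X) ↔
      ∃ G₁ G₂ : Graph α β,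
        G₁ ≤ G ∧ G₂ ≤ G ∧ Disjoint E(G₁) E(G₂) ∧
        V(G₁) ∪ V(G₂) = V(G) ∧ E(G₁) ∪ E(G₂) = E(G) ∧
        (((V(G₁) ∩ V(G₂)).ncard ≤ 2 ∧ {e : E(G) | e ∈ S ∧ (e : β) ∈ E(G₁)}.ncard = 2) ∨
         ((V(G₁) ∩ V(G₂)).ncard = 1 ∧ {e : E(G) | e ∈ S ∧ (e : β) ∈ E(G₁)}.ncard = 1)) := by
  have hinj : Function.Injective (Subtype.val : E(G) → β) := Subtype.val_injective
  constructor
  · rintro ⟨X, hX⟩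
    obtain ⟨e₀, -⟩ : S.Nonempty := Finset.card_pos.1 (by omega)
    obtain ⟨P, hP⟩ := hX.exists_separates (hG.linked o) (hG.ends_univ o e₀)
    have hV : (V(edgeSubgraph o P) ∩ V(edgeSubgraph o Pᶜ)).ncard =
        (ends o.tail o.head P ∩ ends o.tail o.head Pᶜ).card := by
      rw [← Set.ncard_coe_finset, Finset.coe_inter,
        ← Set.ncard_image_of_injective _ (Subtype.val_injective (p := (· ∈ V(G)))),
        Set.image_inter Subtype.val_injective]
      rfl
    have hE : {e : E(G) | e ∈ S ∧ (e : β) ∈ E(edgeSubgraph o P)}.ncard = (P ∩ S).card := by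
      rw [← Set.ncard_coe_finset]
      congr 1
      ext e
      simp only [Set.mem_ofPred_eq, mem_edgeSet_edgeSubgraph, hinj.eq_iff, exists_eq_right,
        Finset.coe_inter, Set.mem_inter_iff, Finset.mem_coe]
      exact and_comm
    refine ⟨edgeSubgraph o P, edgeSubgraph o Pᶜ, edgeSubgraph_le o P, edgeSubgraph_le o Pᶜ,
      ?_, ?_, ?_, ?_⟩
    · rw [Set.disjoint_left]
      intro e he he'
      rw [mem_edgeSet_edgeSubgraph] at he he'
      obtain ⟨f, hf, rfl⟩ := he
      obtain ⟨f', hf', heq⟩ := he'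
      exact Finset.mem_compl.1 hf' (hinj heq ▸ hf)
    · change (↑) '' (ends o.tail o.head P : Set V(G)) ∪
        (↑) '' (ends o.tail o.head Pᶜ : Set V(G)) = V(G)
      rw [← Set.image_union, ← Finset.coe_union, ← ends_union, Finset.union_compl,
        hG.ends_univ o e₀, Finset.coe_univ, Set.image_univ, Subtype.range_coe]
    · ext e
      rw [Set.mem_union, mem_edgeSet_edgeSubgraph, mem_edgeSet_edgeSubgraph]
      constructor
      · rintro (⟨f, -, rfl⟩ | ⟨f, -, rfl⟩) <;> exact f.2
      · intro he
        by_cases hmem : (⟨e, he⟩ : E(G)) ∈ P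
        · exact Or.inl ⟨_, hmem, rfl⟩
        · exact Or.inr ⟨_, Finset.mem_compl.2 hmem, rfl⟩
    · rw [hV, hE]
      exact hP
  · rintro ⟨G₁, G₂, hG₁, hG₂, hdE, hVu, hEu, hcases⟩
    have : DecidablePred fun e : E(G) => (e : β) ∈ E(G₁) := Classical.decPred _
    have : DecidablePred fun v : V(G) => (v : α) ∈ V(G₁) := Classical.decPred _
    have : DecidablePred fun v : V(G) => (v : α) ∈ V(G₂) := Classical.decPred _
    let X : Finset E(G) := Finset.univ.filter fun e => (e : β) ∈ E(G₁)
    let T₁ : Finset V(G) := Finset.univ.filter fun v => (v : α) ∈ V(G₁)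
    let T₂ : Finset V(G) := Finset.univ.filter fun v => (v : α) ∈ V(G₂)
    have hXc : ∀ e ∈ Xᶜ, (e : β) ∈ E(G₂) := by
      intro e he
      have h1 : (e : β) ∈ E(G₁) ∪ E(G₂) := by rw [hEu]; exact e.2
      simp only [X, Finset.mem_compl, Finset.mem_filter, Finset.mem_univ, true_and] at he
      exact h1.resolve_left he
    have hends : ∀ (H : Graph α β), H ≤ G → ∀ e : E(G), (e : β) ∈ E(H) →
        (o.tail e : α) ∈ V(H) ∧ (o.head e : α) ∈ V(H) := by
      intro H hH e he
      have := (hH.isLink_iff he).2 (o.isLink e)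
      exact ⟨this.left_mem, this.right_mem⟩
    have hX1 : ends o.tail o.head X ⊆ T₁ := by
      intro v hv
      obtain ⟨e, he, rfl | rfl⟩ := mem_ends.1 hv <;>
        simp only [X, Finset.mem_filter, Finset.mem_univ, true_and, T₁] at he ⊢
      · exact (hends G₁ hG₁ e he).1
      · exact (hends G₁ hG₁ e he).2
    have hX2 : ends o.tail o.head Xᶜ ⊆ T₂ := by
      intro v hv
      obtain ⟨e, he, rfl | rfl⟩ := mem_ends.1 hv <;>
        simp only [Finset.mem_filter, Finset.mem_univ, true_and, T₂]
      · exact (hends G₂ hG₂ e (hXc e he)).1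
      · exact (hends G₂ hG₂ e (hXc e he)).2
    have hXS : {e : E(G) | e ∈ S ∧ (e : β) ∈ E(G₁)}.ncard = (X ∩ S).card := by
      rw [← Set.ncard_coe_finset]
      congr 1
      ext e
      simp [X, and_comm]
    have hT : (V(G₁) ∩ V(G₂)).ncard = (T₁ ∩ T₂).card := by
      rw [← Set.ncard_coe_finset,
        ← Set.ncard_image_of_injective _ (Subtype.val_injective (p := (· ∈ V(G))))]
      congr 1
      ext v
      constructor
      · intro hv
        exact ⟨⟨v, hG₁.vertexSet_mono hv.1⟩, by simpa [T₁, T₂] using hv, rfl⟩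
      · rintro ⟨w, hw, rfl⟩
        simpa [T₁, T₂] using hw
    have hTu : T₁ ∪ T₂ = Finset.univ := by
      rw [Finset.eq_univ_iff_forall]
      intro v
      have h1 : (v : α) ∈ V(G₁) ∪ V(G₂) := by rw [hVu]; exact v.2
      simpa [T₁, T₂] using h1
    have hcard := Finset.card_union_add_card_inter T₁ T₂
    rw [hTu, Finset.card_univ] at hcard
    rw [hT, hXS] at hcases
    have hsum : (X ∩ S).card + (Xᶜ ∩ S).card = 4 := by
      rw [← card_union_inter_of_disjoint S disjoint_compl_right, Finset.union_compl,
        Finset.univ_inter, hS]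
    -- Both sides contain a marked edge, so their vertex sets are nonempty and the bound `r + 1 ≤
    -- |V(Gᵢ)|` applies.
    have hne : ∀ Y : Finset E(G), 0 < (Y ∩ S).card → (ends o.tail o.head Y).Nonempty := by
      intro Y hY
      obtain ⟨e, he⟩ := Finset.card_pos.1 hY
      exact ⟨_, mem_ends.2 ⟨e, (Finset.mem_inter.1 he).1, Or.inl rfl⟩⟩
    have h1 := edgeRank_add_one_le hX1 ((hne X (by omega)).mono hX1)
    have h2 := edgeRank_add_one_le hX2 ((hne Xᶜ (by omega)).mono hX2)
    rcases hcases with ⟨hle, h2S⟩ | ⟨hle, h1S⟩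
    · exact ⟨X, h2S, by omega, by omega⟩
    -- With a single shared vertex the rank sum is at most `|V| - 1`, which leaves room to move one
    -- marked edge `f` into `X`.
    · obtain ⟨f, hf⟩ := Finset.card_pos.1 (show 0 < (Xᶜ ∩ S).card by omega)
      rw [Finset.mem_inter, Finset.mem_compl] at hf
      have hcard1 : (insert f X ∩ S).card = 2 := by
        rw [Finset.insert_inter_of_mem hf.2, Finset.card_insert_of_notMem (by simp [hf.1]), h1S]
      have hsum' : (insert f X ∩ S).card + ((insert f X)ᶜ ∩ S).card = 4 := by
        rw [← card_union_inter_of_disjoint S disjoint_compl_right, Finset.union_compl,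
          Finset.univ_inter, hS]
      have h3 := edgeRank_insert_le (t := o.tail) (h := o.head) f X
      have h4 := edgeRank_mono (t := o.tail) (h := o.head) _ _
        (Finset.compl_subset_compl.2 (Finset.subset_insert f X))
      exact ⟨insert f X, hcard1, by omega, by omega⟩

end graph

end SplitGraph

theorem mainTheorem5 {α β : Type*} (G : Graph α β)
    [Fintype V(G)] [DecidableEq V(G)] [Fintype E(G)] [LinearOrder E(G)]
    (hG : SplitGraph.IsConnected G)
    (o : SplitGraph.Orientation G) (v₀ : V(G))
    (S : Finset E(G)) (hS : S.card = 4) :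
    (∃ (S₁ S₂ : Finset E(G)) (h₁ : S₁.card = 2) (h₂ : S₂.card = 2),
      Disjoint S₁ S₂ ∧ S₁ ∪ S₂ = S ∧
        SplitGraph.dodgson o v₀ S₁ S₂ (h₁.trans h₂.symm) = 0) ↔
    ∃ G₁ G₂ : Graph α β,
      G₁ ≤ G ∧ G₂ ≤ G ∧ Disjoint E(G₁) E(G₂) ∧
      V(G₁) ∪ V(G₂) = V(G) ∧ E(G₁) ∪ E(G₂) = E(G) ∧
      (((V(G₁) ∩ V(G₂)).ncard ≤ 2 ∧ {e : E(G) | e ∈ S ∧ (e : β) ∈ E(G₁)}.ncard = 2) ∨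
       ((V(G₁) ∩ V(G₂)).ncard = 1 ∧ {e : E(G) | e ∈ S ∧ (e : β) ∈ E(G₁)}.ncard = 1)) :=
  (SplitGraph.exists_dodgson_eq_zero_iff hG o v₀).trans (SplitGraph.exists_goodSide_iff hG o hS)
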